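/- Let $S$ be a (nonempty) inverse semigroup with set of idempotents $E$, and let $\ell^1(S)$, $\ell^1(E)$ be the complex convolution algebras, with point masses $\delta_s$. Let $\ell^1(E)$ act on $\ell^1(S)$ by the bounded bilinear actions determined by $\delta_e\cdot\delta_s=\delta_s$ and $\delta_s\cdot\delta_e=\delta_{se}$ ($s\in S$, $e\in E$). Let $\mathcal T_0=\left\{\begin{bmatrix}a&m\\0&b\end{bmatrix}: a,m,b\in\ell^1(S)\right\}$ be the triangular Banach algebra with the usual matrix operations and norm $\|a\|+\|m\|+\|b\|$, and let $\mathfrak T_0=\left\{\begin{bmatrix}\alpha&0\\0&\alpha\end{bmatrix}:\alpha\in\ell^1(E)\right\}$ act on it on both sides entrywise, through the actions of $\ell^1(E)$ on $\ell^1(S)$. For a Banach algebra $\mathcal A$ that is a Banach $\mathfrak A$-bimodule with compatible actions ($\alpha\cdot(ab)=(\alpha\cdot a)b$ and $(ab)\cdot\alpha=a(b\cdot\alpha)$), let $J_{\mathcal A}$ be the closed two-sided ideal of $\mathcal A$ generated by the elements $(a\cdot\alpha)b-a(\alpha\cdot b)$ with $a,b\in\mathcal A$, $\alpha\in\mathfrak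 A$. Call $\mathcal A$ *$\mathfrak A$-module Arens regular* if $\Gamma_1\Box\Gamma_2-\Gamma_1\diamond\Gamma_2\in J_{\mathcal A}^{\perp\perp}$ for all $\Gamma_1,\Gamma_2\in\mathcal A^{**}$, where $\Box$ and $\diamond$ are the first and second Arens products. Then $\mathcal T_0$ is $\mathfrak T_0$-module Arens regular if and only if $\ell^1(S)$ is $\ell^1(E)$-module Arens regular; and $\mathcal T_0$ is $\mathfrak T_0$-module Arens regular if and only if the maximal group homomorphic image $G_S$ of $S$ (the quotient of $S$ by its least group congruence) is finite. -/

import Mathlib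

open scoped Topology

noncomputable section

/-! ### Inverse semigroups, idempotents, the maximal group homomorphic image -/

/-- Every element `s` has exactly one `t` with `s t s = s` and `t s t = t`. -/
class IsInverseSemigroup (S : Type*) [Semigroup S] : Prop where
  existsUnique_inv : ∀ s : S, ∃! t : S, s * t * s = s ∧ t * s * t = t

theorem IsInverseSemigroup.mul_idem {S : Type*} [Semigroup S] [IsInverseSemigroup S] {e f : S}
    (he : e * e = e) (hf : f * f = f) : (e * f) * (e * f) = e * f := by
  have a3 : ∀ a b c : S, a * b * c = a * (b * c) := mul_assoc
  have he' : ∀ z : S, e * (e * z) = e * z := fun z => by rw [← a3, he]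
  have hf' : ∀ z : S, f * (f * z) = f * z := fun z => by rw [← a3, hf]
  obtain ⟨x, ⟨h1, h2⟩, hu⟩ := existsUnique_inv (e * f)
  have hx : f * x * e = x := by
    apply hu
    constructor
    · simp only [a3, he', hf'] at h1 ⊢
      exact h1
    · simp only [a3, he', hf']
      have := congrArg (fun z => f * (z * e)) h2
      simpa only [a3] using this
  have hxx : x * x = x := by
    have : (f * x * e) * (f * x * e) = f * x * e := by
      have := congrArg (fun z => f * (z * e)) h2
      simpa only [a3] using this
    rwa [hx] at this
  obtain ⟨y, -, hy⟩ := existsUnique_inv x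
  have e1 : x = y := hy x ⟨by rw [hxx, hxx], by rw [hxx, hxx]⟩
  have e2 : e * f = y := hy (e * f) ⟨h2, h1⟩
  rw [e2, ← e1, hxx]

/-- The set `E` of idempotents of `S`. -/
def Idem (S : Type*) [Semigroup S] : Type _ := {e : S // e * e = e}

/-- `E` is a subsemigroup of an inverse semigroup `S`. -/
instance Idem.instSemigroup (S : Type*) [Semigroup S] [IsInverseSemigroup S] :
    Semigroup (Idem S) where
  mul e f := ⟨e.1 * f.1, IsInverseSemigroup.mul_idem e.2 f.2⟩
  mul_assoc e f g := Subtype.ext (mul_assoc e.1 f.1 g.1)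

theorem Idem.coe_mul {S : Type*} [Semigroup S] [IsInverseSemigroup S] (e f : Idem S) :
    (e * f).1 = e.1 * f.1 := rfl

/-- A congruence `c` on `S` is a group congruence if the quotient semigroup `S / c` is a group. -/
def IsGroupCon {S : Type*} [Semigroup S] (c : Con S) : Prop :=
  ∃ e : c.Quotient, (∀ x : c.Quotient, e * x = x) ∧ ∀ x : c.Quotient, ∃ y : c.Quotient, y * x = e

/-- The least group congruence on `S`: the intersection of all group congruences. -/
def leastGroupCon (S : Type*) [Semigroup S] : Con S := sInf {c : Con S | IsGroupCon c}

theorem IsGroupCon.idem {S : Type*} [Semigroup S] {c : Con S} (hc : IsGroupCon c) :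
    ∃ e : c.Quotient, (∀ x, e * x = x) ∧ (∀ x : c.Quotient, ∃ y, y * x = e) ∧
      ∀ x : c.Quotient, x * x = x → x = e := by
  obtain ⟨e, h1, h2⟩ := hc
  refine ⟨e, h1, h2, fun x hx => ?_⟩
  obtain ⟨y, hy⟩ := h2 x
  calc x = e * x := (h1 x).symm
    _ = y * x := by rw [← hy, mul_assoc, hx]
    _ = e := hy

/-- On an inverse semigroup the least group congruence is itself a group congruence. -/
theorem isGroupCon_leastGroupCon (S : Type*) [Semigroup S] [IsInverseSemigroup S] [Nonempty S] :
    IsGroupCon (leastGroupCon S) := by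
  obtain ⟨s₀⟩ := ‹Nonempty S›
  obtain ⟨t₀, ⟨h₀, -⟩, -⟩ := IsInverseSemigroup.existsUnique_inv s₀
  have hi : (t₀ * s₀) * (t₀ * s₀) = t₀ * s₀ := by
    rw [mul_assoc, ← mul_assoc s₀, h₀]
  have key : ∀ {c : Con S}, IsGroupCon c → ∀ f : S, f * f = f → ∀ x : S,
      c (f * x) x ∧ c f (t₀ * s₀) := by
    intro c hc f hf x
    obtain ⟨e, h1, -, h3⟩ := hc.idem
    have hfe : (f : c.Quotient) = e := h3 _ (by rw [← Con.coe_mul, hf])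
    have hte : ((t₀ * s₀ : S) : c.Quotient) = e := h3 _ (by rw [← Con.coe_mul, hi])
    exact ⟨(Con.eq c).1 (by rw [Con.coe_mul, hfe, h1]), (Con.eq c).1 (by rw [hfe, hte])⟩
  refine ⟨((t₀ * s₀ : S) : (leastGroupCon S).Quotient), fun x => ?_, fun x => ?_⟩
  · induction x using Con.induction_on with
    | _ x =>
      rw [← Con.coe_mul, Con.eq]
      exact fun c hc => (key hc _ hi x).1
  · induction x using Con.induction_on with
    | _ x =>
      obtain ⟨t, ⟨ht, -⟩, -⟩ := IsInverseSemigroup.existsUnique_inv x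
      refine ⟨(t : (leastGroupCon S).Quotient), ?_⟩
      rw [← Con.coe_mul, Con.eq]
      exact fun c hc => (key hc (t * x) (by rw [mul_assoc, ← mul_assoc x, ht]) x).2

/-- The maximal group homomorphic image `G_S` of `S`: the quotient by the least group
congruence. -/
def MaxGroupImage (S : Type*) [Semigroup S] : Type _ := (leastGroupCon S).Quotient

/-! ### The Banach spaces `ℓ¹(X)` and the Banach algebra `ℓ¹(S)` -/

/-- `ℓ¹(X)` over the complex numbers. -/
abbrev L1 (X : Type*) : Type _ := lp (fun _ : X => ℂ) 1

namespace L1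

/-- The point mass `δ_x`. -/
def delta {X : Type*} (x : X) : L1 X := by
  classical exact lp.single 1 x (1 : ℂ)

theorem norm_delta {X : Type*} (x : X) : ‖delta x‖ = 1 := by
  classical
  simp [delta, lp.norm_single]

theorem delta_apply {X : Type*} [DecidableEq X] (x y : X) :
    delta x y = if x = y then 1 else 0 := by
  have : delta x = lp.single 1 x (1 : ℂ) := by unfold delta; congr!
  rw [this, lp.single_apply, Pi.single_apply]
  simp [eq_comm]

theorem hasSum_norm {X : Type*} (f : L1 X) : HasSum (fun x => ‖f x‖) ‖f‖ := by
  simpa using lp.hasSum_norm (p := 1) (by simp) f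

theorem hasSum_delta {X : Type*} (f : L1 X) : HasSum (fun x => f x • delta x) f := by
  classical
  have h := lp.hasSum_single (p := 1) (by simp) f
  have e : (fun x => f x • delta x) = fun x => lp.single 1 x (f x) := by
    funext x
    ext y
    rw [lp.coeFn_smul, Pi.smul_apply, delta_apply, lp.single_apply, Pi.single_apply]
    simp [eq_comm]
  rw [e]
  convert h

variable {X Y Z V : Type*} [NormedAddCommGroup V] [NormedSpace ℂ V] [CompleteSpace V]

theorem summable_smul (φ : X → V) (h : ∀ x, ‖φ x‖ ≤ 1) (f : L1 X) :
    Summable fun x => f x • φ x := by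
  refine Summable.of_norm_bounded (hasSum_norm f).summable fun x => ?_
  rw [norm_smul]
  exact mul_le_of_le_one_right (norm_nonneg _) (h x)

/-- The bounded linear map `f ↦ ∑ₓ f(x) φ(x)`, for `φ` bounded by one. -/
def lift (φ : X → V) (h : ∀ x, ‖φ x‖ ≤ 1) : L1 X →L[ℂ] V :=
  LinearMap.mkContinuous
    { toFun := fun f => ∑' x, f x • φ x
      map_add' := fun f g => by
        rw [← (summable_smul φ h f).tsum_add (summable_smul φ h g)]
        exact tsum_congr fun x => add_smul _ _ _
      map_smul' := fun c f => by
        rw [RingHom.id_apply, ← (summable_smul φ h f).tsum_const_smul c]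
        exact tsum_congr fun x => by
          rw [lp.coeFn_smul, Pi.smul_apply, smul_assoc] }
    1 fun f => by
      refine (tsum_of_norm_bounded (hasSum_norm f) fun x => ?_).trans_eq (one_mul _).symm
      rw [norm_smul]
      exact mul_le_of_le_one_right (norm_nonneg _) (h x)

theorem lift_apply (φ : X → V) (h : ∀ x, ‖φ x‖ ≤ 1) (f : L1 X) :
    lift φ h f = ∑' x, f x • φ x := rfl

theorem norm_lift_le (φ : X → V) (h : ∀ x, ‖φ x‖ ≤ 1) : ‖lift φ h‖ ≤ 1 :=
  LinearMap.mkContinuous_norm_le _ zero_le_one _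

theorem lift_delta (φ : X → V) (h : ∀ x, ‖φ x‖ ≤ 1) (x : X) : lift φ h (delta x) = φ x := by
  classical
  rw [lift_apply, tsum_eq_single x]
  · simp [delta_apply]
  · intro y hy
    simp [delta_apply, hy.symm]

theorem clm_ext {W : Type*} [NormedAddCommGroup W] [NormedSpace ℂ W] {F G : L1 X →L[ℂ] W}
    (h : ∀ x, F (delta x) = G (delta x)) : F = G := by
  ext f
  have h1 := (hasSum_delta f).mapL F
  have h2 := (hasSum_delta f).mapL G
  simp only [map_smul, h] at h1 h2
  exact h1.unique h2

/-- The bounded bilinear map `ℓ¹(X) × ℓ¹(Y) → ℓ¹(Z)` with `(δ_x, δ_y) ↦ δ_{op x y}`, that is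
`(f, g) ↦ ∑ₓ f(x) ∑_y g(y) δ_{op x y}`. -/
def bilin (op : X → Y → Z) : L1 X →L[ℂ] L1 Y →L[ℂ] L1 Z :=
  lift (fun x => lift (fun y => delta (op x y)) fun _ => (norm_delta _).le)
    fun _ => norm_lift_le _ _

theorem bilin_delta (op : X → Y → Z) (x : X) (y : Y) :
    bilin op (delta x) (delta y) = delta (op x y) := by
  rw [bilin, lift_delta, lift_delta]

theorem norm_bilin_le (op : X → Y → Z) (f : L1 X) (g : L1 Y) :
    ‖bilin op f g‖ ≤ ‖f‖ * ‖g‖ := by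
  refine (ContinuousLinearMap.le_opNorm₂ _ f g).trans ?_
  have : ‖bilin op‖ ≤ 1 := norm_lift_le _ _
  rw [mul_assoc]
  exact mul_le_of_le_one_left (by positivity) this

/-- The product of `ℓ¹(S)` is convolution, `δ_s * δ_t = δ_{st}`. -/
instance instMul (S : Type*) [Semigroup S] : Mul (L1 S) := ⟨fun f g => bilin (· * ·) f g⟩

theorem mul_def {S : Type*} [Semigroup S] (f g : L1 S) : f * g = bilin (· * ·) f g := rfl

theorem delta_mul_delta {S : Type*} [Semigroup S] (s t : S) :
    delta s * delta t = delta (s * t) := bilin_delta _ s t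

/-- The coefficient formula `(f * g)(u) = ∑_{s t = u} f(s) g(t)`. -/
theorem mul_apply {S : Type*} [Semigroup S] [DecidableEq S] (f g : L1 S) (u : S) :
    (f * g) u = ∑' s, ∑' t, if s * t = u then f s * g t else 0 := by
  have ev : ∀ (φ : S → L1 S) (h : ∀ x, ‖φ x‖ ≤ 1) (k : L1 S),
      lift φ h k u = ∑' x, k x * φ x u := fun φ h k =>
    (((lp.evalCLM ℂ (fun _ : S => ℂ) 1 u).hasSum (summable_smul φ h k).hasSum).tsum_eq).symm
  have h2 := (((lp.evalCLM ℂ (fun _ : S => ℂ) 1 u).comp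
    ((bilin fun s t : S => s * t).flip g)).hasSum (hasSum_delta f).summable.hasSum).tsum_eq
  rw [(hasSum_delta f).tsum_eq] at h2
  refine h2.symm.trans (tsum_congr fun s => ?_)
  have h3 : bilin (fun s t : S => s * t) (delta s) g u = ∑' t, g t * delta (s * t) u := by
    rw [bilin, lift_delta, ev]
  have h4 : ((lp.evalCLM ℂ (fun _ : S => ℂ) 1 u).comp
      ((bilin fun s t : S => s * t).flip g)) (f s • delta s) =
      f s * bilin (fun s t : S => s * t) (delta s) g u := by
    rw [map_smul]
    rfl
  refine h4.trans ?_
  rw [h3, ← tsum_mul_left]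
  refine tsum_congr fun t => ?_
  rw [delta_apply]
  split_ifs <;> simp

/-- To prove an identity between bounded trilinear expressions, test it on point masses. -/
theorem trilin_ext {X Y Z : Type*} {W : Type*} [NormedAddCommGroup W] [NormedSpace ℂ W]
    {F G : L1 X →L[ℂ] L1 Y →L[ℂ] L1 Z →L[ℂ] W}
    (h : ∀ x y z, F (delta x) (delta y) (delta z) = G (delta x) (delta y) (delta z)) : F = G :=
  clm_ext fun x => clm_ext fun y => clm_ext fun z => h x y z

/-- Two ways of composing bilinear extensions agree when the operations do. -/
theorem bilin_assoc {X Y Z P Q W : Type*} (o₁ : X → Y → P) (o₂ : P → Z → W) (o₃ : Y → Z → Q)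
    (o₄ : X → Q → W) (h : ∀ x y z, o₂ (o₁ x y) z = o₄ x (o₃ y z)) (f : L1 X) (g : L1 Y)
    (k : L1 Z) : bilin o₂ (bilin o₁ f g) k = bilin o₄ f (bilin o₃ g k) := by
  have key : ((ContinuousLinearMap.compL ℂ (L1 Y) (L1 P) (L1 Z →L[ℂ] L1 W)) (bilin o₂)) ∘L
        bilin o₁ =
      ((ContinuousLinearMap.compL ℂ (L1 Y) (L1 Z →L[ℂ] L1 Q) (L1 Z →L[ℂ] L1 W)).flip
        (bilin o₃)) ∘L (ContinuousLinearMap.compL ℂ (L1 Z) (L1 Q) (L1 W)) ∘L bilin o₄ :=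
    trilin_ext fun x y z => by simp [bilin_delta, h]
  exact congrArg (fun F => F f g k) key

theorem bilin_swap {X Y Z : Type*} (op : X → Y → Z) (f : L1 X) (g : L1 Y) :
    bilin op f g = bilin (fun y x => op x y) g f := by
  have key : bilin op = (bilin fun y x => op x y).flip :=
    clm_ext fun x => clm_ext fun y => by simp [bilin_delta]
  exact congrArg (fun F => F f g) key

/-- `ℓ¹(S)` is a Banach algebra under convolution. -/
instance instNonUnitalNormedRing (S : Type*) [Semigroup S] : NonUnitalNormedRing (L1 S) where
  __ := (inferInstance : NormedAddCommGroup (L1 S))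
  __ := instMul S
  left_distrib f g h := map_add (bilin _ f) g h
  right_distrib f g h := by simp [mul_def]
  zero_mul f := by simp [mul_def]
  mul_zero f := by simp [mul_def]
  mul_assoc f g h := bilin_assoc _ _ _ _ mul_assoc f g h
  norm_mul_le f g := norm_bilin_le _ f g

instance instIsScalarTower (S : Type*) [Semigroup S] : IsScalarTower ℂ (L1 S) (L1 S) :=
  ⟨fun c f g => by simp [smul_eq_mul, mul_def]⟩

instance instSMulCommClass (S : Type*) [Semigroup S] : SMulCommClass ℂ (L1 S) (L1 S) :=
  ⟨fun c f g => by simp [smul_eq_mul, mul_def]⟩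

end L1

/-! ### Banach modules with compatible actions -/

/-- The data making the Banach algebra `A` a Banach `𝔄`-bimodule with compatible actions:
`left α a = α · a` and `right α a = a · α`. -/
structure CompatibleActions (𝔄 A : Type*) [NonUnitalNormedRing 𝔄] [NormedSpace ℂ 𝔄]
    [NonUnitalNormedRing A] [NormedSpace ℂ A] where
  left : 𝔄 →L[ℂ] A →L[ℂ] A
  right : 𝔄 →L[ℂ] A →L[ℂ] A
  left_mul : ∀ α β a, left (α * β) a = left α (left β a)
  right_mul : ∀ α β a, right (α * β) a = right β (right α a)
  left_right : ∀ α β a, right β (left α a) = left α (right β a)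
  left_alg : ∀ α a b, left α (a * b) = left α a * b
  right_alg : ∀ α a b, right α (a * b) = a * right α b

/-- `ℓ¹(E)` acts on `ℓ¹(S)` trivially from the left and by multiplication from the right:
`δ_e · δ_s = δ_s` and `δ_s · δ_e = δ_{se}`. -/
def semigroupActions (S : Type*) [Semigroup S] [IsInverseSemigroup S] :
    CompatibleActions (L1 (Idem S)) (L1 S) where
  left := L1.bilin fun _ s => s
  right := L1.bilin fun e s => s * e.1
  left_mul α β a := L1.bilin_assoc (· * ·) (fun _ s => s) (fun _ s => s) (fun _ s => s)
    (fun _ _ _ => rfl) α β a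
  right_mul α β a := by
    simp only [L1.bilin_swap (fun (e : Idem S) (s : S) => s * e.1)]
    exact (L1.bilin_assoc (fun (s : S) (e : Idem S) => s * e.1)
      (fun (s : S) (e : Idem S) => s * e.1) (· * ·) (fun (s : S) (e : Idem S) => s * e.1)
      (fun s e f => mul_assoc s e.1 f.1) a α β).symm
  left_right α β a := by
    simp only [L1.bilin_swap (fun (e : Idem S) (s : S) => s * e.1)]
    exact L1.bilin_assoc (fun _ s => s) (fun (s : S) (e : Idem S) => s * e.1)
      (fun (s : S) (e : Idem S) => s * e.1) (fun _ s => s) (fun _ _ _ => rfl) α a β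
  left_alg α a b := (L1.bilin_assoc (fun _ s => s) (· * ·) (· * ·) (fun _ s => s)
    (fun _ _ _ => rfl) α a b).symm
  right_alg α a b := by
    simp only [L1.bilin_swap (fun (e : Idem S) (s : S) => s * e.1)]
    exact L1.bilin_assoc (· * ·) (fun (s : S) (e : Idem S) => s * e.1)
      (fun (s : S) (e : Idem S) => s * e.1) (· * ·) (fun s t e => mul_assoc s t e.1) a b α

/-! ### Triangular Banach algebras -/

/-- The triangular Banach algebra of matrices `[[a, m], [0, b]]` with `a, m, b ∈ A`, with the norm
`‖a‖ + ‖m‖ + ‖b‖`. The indices `0, 1, 2` stand for the entries `a, m, b`. -/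
def Tri (A : Type*) : Type _ := PiLp 1 (fun _ : Fin 3 => A)

namespace Tri

/-- The matrix `[[a, m], [0, b]]`. -/
def mk {A : Type*} (a m b : A) : Tri A := WithLp.toLp 1 ![a, m, b]

/-- The entry `a` of `[[a, m], [0, b]]`. -/
def a {A : Type*} (t : Tri A) : A := WithLp.ofLp t 0

/-- The entry `m` of `[[a, m], [0, b]]`. -/
def m {A : Type*} (t : Tri A) : A := WithLp.ofLp t 1

/-- The entry `b` of `[[a, m], [0, b]]`. -/
def b {A : Type*} (t : Tri A) : A := WithLp.ofLp t 2

@[simp] theorem mk_a {A : Type*} (x y z : A) : (mk x y z).a = x := rfl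
@[simp] theorem mk_m {A : Type*} (x y z : A) : (mk x y z).m = y := rfl
@[simp] theorem mk_b {A : Type*} (x y z : A) : (mk x y z).b = z := rfl

theorem ext {A : Type*} {s t : Tri A} (h0 : s.a = t.a) (h1 : s.m = t.m) (h2 : s.b = t.b) :
    s = t := by
  apply WithLp.ofLp_injective
  funext i
  fin_cases i
  exacts [h0, h1, h2]

section

variable {A : Type*} [NonUnitalNormedRing A]

instance instNormedAddCommGroup : NormedAddCommGroup (Tri A) :=
  inferInstanceAs (NormedAddCommGroup (PiLp 1 (fun _ : Fin 3 => A)))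

instance instNormedSpace [NormedSpace ℂ A] : NormedSpace ℂ (Tri A) :=
  inferInstanceAs (NormedSpace ℂ (PiLp 1 (fun _ : Fin 3 => A)))

instance instCompleteSpace [CompleteSpace A] : CompleteSpace (Tri A) :=
  inferInstanceAs (CompleteSpace (PiLp 1 (fun _ : Fin 3 => A)))

theorem norm_eq (t : Tri A) : ‖t‖ = ‖t.a‖ + ‖t.m‖ + ‖t.b‖ := by
  refine (PiLp.norm_eq_of_L1 (β := fun _ : Fin 3 => A) t).trans ?_
  rw [Fin.sum_univ_three]
  rfl

theorem norm_a_le (t : Tri A) : ‖t.a‖ ≤ ‖t‖ := by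
  rw [norm_eq]
  linarith [norm_nonneg t.m, norm_nonneg t.b]

@[simp] theorem zero_a : (0 : Tri A).a = 0 := rfl
@[simp] theorem zero_m : (0 : Tri A).m = 0 := rfl
@[simp] theorem zero_b : (0 : Tri A).b = 0 := rfl
@[simp] theorem add_a (s t : Tri A) : (s + t).a = s.a + t.a := rfl
@[simp] theorem add_m (s t : Tri A) : (s + t).m = s.m + t.m := rfl
@[simp] theorem add_b (s t : Tri A) : (s + t).b = s.b + t.b := rfl
@[simp] theorem smul_a [NormedSpace ℂ A] (c : ℂ) (t : Tri A) : (c • t).a = c • t.a := rfl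
@[simp] theorem smul_m [NormedSpace ℂ A] (c : ℂ) (t : Tri A) : (c • t).m = c • t.m := rfl
@[simp] theorem smul_b [NormedSpace ℂ A] (c : ℂ) (t : Tri A) : (c • t).b = c • t.b := rfl

/-- Formal multiplication of upper triangular matrices. -/
instance instMul : Mul (Tri A) :=
  ⟨fun s t => mk (s.a * t.a) (s.a * t.m + s.m * t.b) (s.b * t.b)⟩

@[simp] theorem mul_a (s t : Tri A) : (s * t).a = s.a * t.a := rfl
@[simp] theorem mul_m (s t : Tri A) : (s * t).m = s.a * t.m + s.m * t.b := rfl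
@[simp] theorem mul_b (s t : Tri A) : (s * t).b = s.b * t.b := rfl

theorem norm_mul_le' (s t : Tri A) : ‖s * t‖ ≤ ‖s‖ * ‖t‖ := by
  simp only [norm_eq, mul_a, mul_m, mul_b]
  have h1 := norm_mul_le s.a t.a
  have h2 := norm_mul_le s.a t.m
  have h3 := norm_mul_le s.m t.b
  have h4 := norm_mul_le s.b t.b
  have h5 := norm_add_le (s.a * t.m) (s.m * t.b)
  have p1 : 0 ≤ ‖s.a‖ * ‖t.b‖ := by positivity
  have p2 : 0 ≤ ‖s.m‖ * ‖t.a‖ := by positivity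
  have p3 : 0 ≤ ‖s.m‖ * ‖t.m‖ := by positivity
  have p4 : 0 ≤ ‖s.b‖ * ‖t.a‖ := by positivity
  have p5 : 0 ≤ ‖s.b‖ * ‖t.m‖ := by positivity
  nlinarith

instance instNonUnitalNormedRing : NonUnitalNormedRing (Tri A) where
  __ := (inferInstance : NormedAddCommGroup (Tri A))
  __ := (instMul : Mul (Tri A))
  left_distrib r s t := ext (by simp [mul_add]) (by simp [mul_add]; abel) (by simp [mul_add])
  right_distrib r s t := ext (by simp [add_mul]) (by simp [add_mul]; abel) (by simp [add_mul])
  zero_mul t := ext (by simp) (by simp) (by simp)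
  mul_zero t := ext (by simp) (by simp) (by simp)
  mul_assoc r s t := ext (by simp [mul_assoc])
    (by simp [mul_assoc, mul_add, add_mul, add_assoc]) (by simp [mul_assoc])
  norm_mul_le := norm_mul_le'

variable [NormedSpace ℂ A]

instance instIsScalarTower [IsScalarTower ℂ A A] : IsScalarTower ℂ (Tri A) (Tri A) :=
  ⟨fun c s t => ext (by simp [smul_mul_assoc])
    (by simp [smul_mul_assoc, smul_add]) (by simp [smul_mul_assoc])⟩

instance instSMulCommClass [SMulCommClass ℂ A A] : SMulCommClass ℂ (Tri A) (Tri A) :=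
  ⟨fun c s t => ext (by simp [mul_smul_comm])
    (by simp [mul_smul_comm, smul_add]) (by simp [mul_smul_comm])⟩

end

/-- The Banach algebra of diagonal matrices `[[α, 0], [0, α]]`, `α ∈ 𝔄`, a subalgebra of the
triangular algebra over `𝔄`. -/
def scalars (𝔄 : Type*) [NonUnitalNormedRing 𝔄] [NormedSpace ℂ 𝔄] :
    NonUnitalSubalgebra ℂ (Tri 𝔄) where
  carrier := {t | t.m = 0 ∧ t.a = t.b}
  zero_mem' := ⟨rfl, rfl⟩
  add_mem' := by
    rintro s t ⟨hs, hs'⟩ ⟨ht, ht'⟩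
    exact ⟨by simp [hs, ht], by simp [hs', ht']⟩
  mul_mem' := by
    rintro s t ⟨hs, hs'⟩ ⟨ht, ht'⟩
    exact ⟨by simp [hs, ht], by simp [hs', ht']⟩
  smul_mem' := by
    rintro c t ⟨ht, ht'⟩
    exact ⟨by simp [ht], by simp [ht']⟩

section

variable {𝔄 A : Type*} [NonUnitalNormedRing 𝔄] [NormedSpace ℂ 𝔄]
  [NonUnitalNormedRing A] [NormedSpace ℂ A]

instance scalars.instNormedSpace : NormedSpace ℂ (scalars 𝔄) where
  norm_smul_le c τ := norm_smul_le c τ.1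

@[simp] theorem scalars.coe_mul (σ τ : scalars 𝔄) : (σ * τ).1 = σ.1 * τ.1 := rfl
@[simp] theorem scalars.coe_add (σ τ : scalars 𝔄) : (σ + τ).1 = σ.1 + τ.1 := rfl
@[simp] theorem scalars.coe_smul (c : ℂ) (τ : scalars 𝔄) : (c • τ).1 = c • τ.1 := rfl

/-- For a bounded bilinear `B`, the bounded bilinear map
`([[α, 0], [0, α]], [[a, m], [0, b]]) ↦ [[B α a, B α m], [0, B α b]]`. -/
def entrywise (B : 𝔄 →L[ℂ] A →L[ℂ] A) : scalars 𝔄 →L[ℂ] Tri A →L[ℂ] Tri A :=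
  LinearMap.mkContinuous₂
    (LinearMap.mk₂ ℂ
      (fun (τ : scalars 𝔄) (t : Tri A) => mk (B τ.1.a t.a) (B τ.1.a t.m) (B τ.1.a t.b))
      (fun σ τ t => ext (by simp) (by simp) (by simp))
      (fun c τ t => ext (by simp) (by simp) (by simp))
      (fun τ s t => ext (by simp) (by simp) (by simp))
      (fun c τ t => ext (by simp) (by simp) (by simp)))
    ‖B‖ fun τ t => by
      have h : ∀ x : A, ‖B τ.1.a x‖ ≤ ‖B‖ * ‖τ‖ * ‖x‖ := fun x =>
        (B.le_opNorm₂ τ.1.a x).trans (by gcongr; exact norm_a_le τ.1)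
      refine (norm_eq _).trans_le ?_
      rw [norm_eq t, mul_add, mul_add]
      exact add_le_add (add_le_add (h _) (h _)) (h _)

theorem entrywise_apply (B : 𝔄 →L[ℂ] A →L[ℂ] A) (τ : scalars 𝔄) (t : Tri A) :
    entrywise B τ t = mk (B τ.1.a t.a) (B τ.1.a t.m) (B τ.1.a t.b) := rfl

/-- The induced entrywise actions of the algebra of diagonal matrices `[[α, 0], [0, α]]` on the
triangular algebra. -/
def actions (X : CompatibleActions 𝔄 A) : CompatibleActions (scalars 𝔄) (Tri A) where
  left := entrywise X.left
  right := entrywise X.right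
  left_mul σ τ t := by
    apply ext <;> simp [entrywise_apply, X.left_mul]
  right_mul σ τ t := by
    apply ext <;> simp [entrywise_apply, X.right_mul]
  left_right σ τ t := by
    apply ext <;> simp [entrywise_apply, X.left_right]
  left_alg τ s t := by
    apply ext <;> simp [entrywise_apply, X.left_alg]
  right_alg τ s t := by
    apply ext <;> simp [entrywise_apply, X.right_alg]

end

end Tri

/-! ### Arens products and module Arens regularity -/

section Arens

variable {A : Type*} [NonUnitalNormedRing A] [NormedSpace ℂ A] [IsScalarTower ℂ A A]
  [SMulCommClass ℂ A A]

/-- For `Γ ∈ A**` and `f ∈ A*`, the functional `a ↦ Γ (b ↦ f (a b))`, linearly in `f`. -/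
def arensAux (M : A →L[ℂ] A →L[ℂ] A) (Γ : StrongDual ℂ (StrongDual ℂ A)) :
    StrongDual ℂ A →L[ℂ] StrongDual ℂ A :=
  (ContinuousLinearMap.compL ℂ A (StrongDual ℂ A) ℂ Γ) ∘L
    ((ContinuousLinearMap.compL ℂ A (A →L[ℂ] A) (StrongDual ℂ A)).flip M) ∘L
      (ContinuousLinearMap.compL ℂ A A ℂ)

/-- The first Arens product on `A**`: `(Γ₁ □ Γ₂)(f) = Γ₁ (a ↦ Γ₂ (b ↦ f (a b)))`. -/
def firstArens (Γ₁ Γ₂ : StrongDual ℂ (StrongDual ℂ A)) : StrongDual ℂ (StrongDual ℂ A) :=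
  Γ₁ ∘L arensAux (ContinuousLinearMap.mul ℂ A) Γ₂

/-- The second Arens product on `A**`: `(Γ₁ ◇ Γ₂)(f) = Γ₂ (b ↦ Γ₁ (a ↦ f (a b)))`. -/
def secondArens (Γ₁ Γ₂ : StrongDual ℂ (StrongDual ℂ A)) : StrongDual ℂ (StrongDual ℂ A) :=
  Γ₂ ∘L arensAux (ContinuousLinearMap.mul ℂ A).flip Γ₁

/-- `Γ₁ □ Γ₂ = w*-lim_i lim_j a_i b_j` whenever `Γ₁ = w*-lim a_i` and `Γ₂ = w*-lim b_j`. -/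
theorem firstArens_iterated_limit {ι κ : Type*} {l : Filter ι} {k : Filter κ}
    (Γ₁ Γ₂ : StrongDual ℂ (StrongDual ℂ A)) (x : ι → A) (y : κ → A)
    (hx : ∀ f : StrongDual ℂ A, Filter.Tendsto (fun i => f (x i)) l (𝓝 (Γ₁ f)))
    (hy : ∀ f : StrongDual ℂ A, Filter.Tendsto (fun j => f (y j)) k (𝓝 (Γ₂ f)))
    (f : StrongDual ℂ A) :
    ∃ z : ι → ℂ, (∀ i, Filter.Tendsto (fun j => f (x i * y j)) k (𝓝 (z i))) ∧
      Filter.Tendsto z l (𝓝 (firstArens Γ₁ Γ₂ f)) :=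
  ⟨fun i => arensAux (ContinuousLinearMap.mul ℂ A) Γ₂ f (x i),
    fun i => hy (f ∘L ContinuousLinearMap.mul ℂ A (x i)), hx _⟩

/-- `Γ₁ ◇ Γ₂ = w*-lim_j lim_i a_i b_j` whenever `Γ₁ = w*-lim a_i` and `Γ₂ = w*-lim b_j`. -/
theorem secondArens_iterated_limit {ι κ : Type*} {l : Filter ι} {k : Filter κ}
    (Γ₁ Γ₂ : StrongDual ℂ (StrongDual ℂ A)) (x : ι → A) (y : κ → A)
    (hx : ∀ f : StrongDual ℂ A, Filter.Tendsto (fun i => f (x i)) l (𝓝 (Γ₁ f)))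
    (hy : ∀ f : StrongDual ℂ A, Filter.Tendsto (fun j => f (y j)) k (𝓝 (Γ₂ f)))
    (f : StrongDual ℂ A) :
    ∃ z : κ → ℂ, (∀ j, Filter.Tendsto (fun i => f (x i * y j)) l (𝓝 (z j))) ∧
      Filter.Tendsto z k (𝓝 (secondArens Γ₁ Γ₂ f)) :=
  ⟨fun j => arensAux (ContinuousLinearMap.mul ℂ A).flip Γ₁ f (y j),
    fun j => hx (f ∘L (ContinuousLinearMap.mul ℂ A).flip (y j)), hy _⟩

/-- The annihilator `W^⊥` in `V*` of a subspace `W` of `V`. -/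
def annihilator {V : Type*} [NormedAddCommGroup V] [NormedSpace ℂ V] (W : Submodule ℂ V) :
    Submodule ℂ (StrongDual ℂ V) where
  carrier := {f | ∀ x ∈ W, f x = 0}
  zero_mem' := fun _ _ => rfl
  add_mem' := fun {f g} hf hg x hx => by
    rw [add_apply, hf x hx, hg x hx, add_zero]
  smul_mem' := fun c f hf x hx => by
    rw [smul_apply, hf x hx, smul_zero]

variable {𝔄 : Type*} [NonUnitalNormedRing 𝔄] [NormedSpace ℂ 𝔄]

/-- The closed two-sided ideal `J_A` of `A` generated by the elements
`(a · α) b - a (α · b)`, for `α ∈ 𝔄` and `a, b ∈ A`. -/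
def CompatibleActions.J (X : CompatibleActions 𝔄 A) : Submodule ℂ A :=
  sInf {I : Submodule ℂ A | IsClosed (I : Set A) ∧
    (∀ x ∈ I, ∀ c : A, c * x ∈ I ∧ x * c ∈ I) ∧
    ∀ (α : 𝔄) (a b : A), X.right α a * b - a * X.left α b ∈ I}

/-- `A` is module Arens regular as a Banach `𝔄`-module:
`Γ₁ □ Γ₂ - Γ₁ ◇ Γ₂ ∈ J_A^{⊥⊥}` for all `Γ₁, Γ₂ ∈ A**`. -/
def CompatibleActions.ModuleArensRegular (X : CompatibleActions 𝔄 A) : Prop :=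
  ∀ Γ₁ Γ₂ : StrongDual ℂ (StrongDual ℂ A),
    firstArens Γ₁ Γ₂ - secondArens Γ₁ Γ₂ ∈ annihilator (annihilator X.J)

end Arens

end

/-! ### Idempotents and the least group congruence -/

/-! Regularity is a condition on functionals `f` in the annihilator of `J`: the two Arens products
must agree at each of them. On point masses the generators of `J` for `ℓ¹(S)` are `δ_{set} - δ_{st}`
with `e` idempotent, so such an `f` ignores idempotents inside products. This forces `s ↦ f(δ_s)` to
be constant on the classes of the least group congruence (`eq_of_leastGroupCon`). Conversely, every
functional pulled back from `ℓ¹(G_S)` kills `J` (`toQuotient_eq_zero`). Hence everything is decided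
by bounded functions on the group `G_S`.

If `G_S` is finite, `(a, b) ↦ f(ab)` is a finite sum of products of functionals, and for such forms
the order of the two limits is irrelevant. The entries of a product of triangular matrices are sums
of four products of entries, so finite rank passes to the triangular algebra
(`Tri.moduleArensRegular_of_finite_rank`).

Regularity of the triangular algebra passes to `ℓ¹(S)`, its first diagonal corner
(`Tri.moduleArensRegular_of_actions`).

If `G_S` is infinite, cancellation gives sequences for which the products `x_n y_m` with `n < m`
avoid those with `n > m` (`exists_seq_mul_ne`). The indicator of the first set of products then has
iterated limits 1 and 0, so `ℓ¹(S)` is not regular. These three implications form a cycle, which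
yields both equivalences. -/

/-- Both `e * f` and `f * e` are inverses of `e * f`, and the inverse is unique. -/
theorem IsInverseSemigroup.idem_comm {S : Type*} [Semigroup S] [IsInverseSemigroup S] {e f : S}
    (he : e * e = e) (hf : f * f = f) : e * f = f * e := by
  have a3 : ∀ a b c : S, a * b * c = a * (b * c) := mul_assoc
  have he' : ∀ z : S, e * (e * z) = e * z := fun z => by rw [← a3, he]
  have hf' : ∀ z : S, f * (f * z) = f * z := fun z => by rw [← a3, hf]
  have h1 := mul_idem he hf
  have h2 := mul_idem hf he
  refine (existsUnique_inv (e * f)).unique ⟨?_, ?_⟩ ⟨?_, ?_⟩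
  · rw [h1, h1]
  · rw [h1, h1]
  · simp only [a3, he', hf'] at h1 ⊢
    exact h1
  · simp only [a3, he', hf'] at h2 ⊢
    exact h2

theorem IsInverseSemigroup.exists_inv {S : Type*} [Semigroup S] [IsInverseSemigroup S] (s : S) :
    ∃ t : S, s * t * s = s ∧ (s * t) * (s * t) = s * t ∧ (t * s) * (t * s) = t * s := by
  obtain ⟨t, ⟨h1, -⟩, -⟩ := existsUnique_inv s
  exact ⟨t, h1, by rw [← mul_assoc, h1], by rw [mul_assoc, ← mul_assoc s, h1]⟩

/-- A function on an inverse semigroup that does not see idempotents inside a product is constant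
on the classes of the least group congruence. -/
theorem eq_of_leastGroupCon {S V : Type*} [Semigroup S] [IsInverseSemigroup S] {φ : S → V}
    (hφ : ∀ s e t : S, e * e = e → φ (s * e * t) = φ (s * t)) {s t : S}
    (h : leastGroupCon S s t) : φ s = φ t := by
  -- The syntactic congruence of `φ`. It identifies all idempotents, so it is a group congruence and
  -- contains the least one.
  let c : Con S :=
    { r := fun x y => ∀ u v, φ (u * x * v) = φ (u * y * v)
      iseqv := ⟨fun _ _ _ => rfl, fun h u v => (h u v).symm,
        fun h h' u v => (h u v).trans (h' u v)⟩
      mul' := by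
        intro w x y z h h' u v
        have h1 := h u (y * v)
        have h2 := h' (u * x) v
        simp only [mul_assoc] at h1 h2 ⊢
        rw [h1, h2] }
  have hce : ∀ e f : S, e * e = e → f * f = f → c e f := fun e f he hf u v => by
    rw [hφ u e v he, hφ u f v hf]
  have hc : IsGroupCon c := by
    obtain ⟨t₀, -, hi, -⟩ := IsInverseSemigroup.exists_inv s
    refine ⟨((s * t₀ : S) : c.Quotient), fun x => ?_, fun x => ?_⟩
    · induction x using Con.induction_on with
      | _ x =>
        rw [← Con.coe_mul, Con.eq]
        intro u v
        rw [← mul_assoc u, mul_assoc _ x, hφ u _ _ hi, ← mul_assoc]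
    · induction x using Con.induction_on with
      | _ x =>
        obtain ⟨y, -, -, hy⟩ := IsInverseSemigroup.exists_inv x
        refine ⟨(y : c.Quotient), ?_⟩
        rw [← Con.coe_mul, Con.eq]
        exact hce _ _ hy hi
  -- The hypothesis removes only interior idempotents. Writing `x = x y x` and commuting `e` past
  -- the idempotent `x y` (or `y x` in `hr`) moves an outer idempotent inside.
  have hl : ∀ e x : S, e * e = e → φ (e * x) = φ x := fun e x he => by
    obtain ⟨y, h1, h2, -⟩ := IsInverseSemigroup.exists_inv x
    conv_lhs => rw [← h1, ← mul_assoc e, IsInverseSemigroup.idem_comm he h2, hφ _ _ _ he, h1]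
  have hr : ∀ e x : S, e * e = e → φ (x * e) = φ x := fun e x he => by
    obtain ⟨y, h1, -, h2⟩ := IsInverseSemigroup.exists_inv x
    conv_lhs => rw [← h1, mul_assoc x, mul_assoc x, IsInverseSemigroup.idem_comm h2 he,
      ← mul_assoc x, hφ _ _ _ he, ← mul_assoc, h1]
  -- `S` need not have an identity, so the idempotent `s * y` serves as both contexts `u` and `v`,
  -- and is then stripped off.
  obtain ⟨y, -, hy, -⟩ := IsInverseSemigroup.exists_inv s
  have key : φ ((s * y) * s * (s * y)) = φ ((s * y) * t * (s * y)) := h c hc _ _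
  rwa [hr _ _ hy, hr _ _ hy, hl _ _ hy, hl _ _ hy] at key

theorem IsGroupCon.cancel {S : Type*} [Semigroup S] {c : Con S} (hc : IsGroupCon c) :
    IsCancelMul c.Quotient := by
  obtain ⟨e, h1, h2⟩ := hc
  choose i hi using h2
  let _ : One c.Quotient := ⟨e⟩
  let _ : Inv c.Quotient := ⟨i⟩
  let _ : Group c.Quotient := Group.ofLeftAxioms mul_assoc h1 hi
  have hl : ∀ a b d : c.Quotient, a * b = a * d → b = d := fun a b d h => mul_left_cancel h
  have hr : ∀ a b d : c.Quotient, b * a = d * a → b = d := fun a b d h => mul_right_cancel h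
  exact { mul_left_cancel := fun a b d h => hl a b d h
          mul_right_cancel := fun a b d h => hr a b d h }

/-! ### Sequences in infinite cancellative semigroups -/

/-- A sequence can be chosen recursively, each term depending on the set of all earlier ones. -/
theorem exists_seq_of_forall_finset {α : Type*} {Q : Finset α → α → Prop}
    (h : ∀ F, ∃ p, Q F p) :
    ∃ (p : ℕ → α) (F : ℕ → Finset α), (∀ m n, m < n → p m ∈ F n) ∧ ∀ n, Q (F n) (p n) := by
  classical
  choose g hg using h
  let F : ℕ → Finset α := fun n => Nat.rec ∅ (fun _ s => insert (g s) s) n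
  have hF : ∀ n, F (n + 1) = insert (g (F n)) (F n) := fun _ => rfl
  have mono : Monotone F := monotone_nat_of_le_succ fun n => by
    rw [hF]
    exact Finset.subset_insert _ _
  refine ⟨fun n => g (F n), F, fun m n hmn => ?_, fun n => hg _⟩
  refine mono (Nat.succ_le_of_lt hmn) ?_
  rw [Nat.succ_eq_add_one, hF]
  exact Finset.mem_insert_self _ _

/-- The pairs `(x n, y n)` are chosen recursively. In any forbidden equality the largest index
occurs on one side only, or as both `m = n'`; cancellation makes each such coincidence exclude
finitely many choices. -/
theorem exists_seq_mul_ne {G : Type*} [Mul G] [IsCancelMul G] [Infinite G] :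
    ∃ x y : ℕ → G, ∀ n m n' m', n < m → m' < n' → x n * y m ≠ x n' * y m' := by
  classical
  have h : ∀ F : Finset (G × G), ∃ p : G × G,
      (∀ a ∈ F, ∀ b ∈ F, ∀ d ∈ F, p.1 * a.2 ≠ b.1 * d.2) ∧
      ∀ a ∈ F, ∀ b ∈ F, ∀ d ∈ F, a.1 * p.2 ≠ b.1 * d.2 ∧ a.1 * p.2 ≠ p.1 * d.2 := by
    intro F
    -- Finitely many injective maps pull a finite set back to a finite set, so an infinite `G` has a
    -- point outside.
    have avoid : ∀ (r : G × G → G → G), (∀ a, Function.Injective (r a)) → ∀ B : Finset G,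
        ∃ z, ∀ a ∈ F, r a z ∉ B := by
      intro r hr B
      have hfin : (⋃ a ∈ F, (r a) ⁻¹' (B : Set G)).Finite :=
        F.finite_toSet.biUnion fun a _ => B.finite_toSet.preimage (hr a).injOn
      obtain ⟨z, hz⟩ := hfin.exists_notMem
      exact ⟨z, fun a ha hB => hz (Set.mem_biUnion ha hB)⟩
    obtain ⟨x, hx⟩ := avoid (fun a z => z * a.2) (fun a => mul_left_injective a.2)
      ((F ×ˢ F).image fun q => q.1.1 * q.2.2)
    obtain ⟨y, hy⟩ := avoid (fun a z => a.1 * z) (fun a => mul_right_injective a.1)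
      (((F ×ˢ F).image fun q => q.1.1 * q.2.2) ∪ F.image fun q => x * q.2)
    refine ⟨(x, y), fun a ha b hb d hd heq => hx a ha ?_, fun a ha b hb d hd =>
      ⟨fun heq => hy a ha ?_, fun heq => hy a ha ?_⟩⟩
    · exact Finset.mem_image.2 ⟨(b, d), Finset.mk_mem_product hb hd, heq.symm⟩
    · exact Finset.mem_union_left _
        (Finset.mem_image.2 ⟨(b, d), Finset.mk_mem_product hb hd, heq.symm⟩)
    · exact Finset.mem_union_right _ (Finset.mem_image.2 ⟨d, hd, heq.symm⟩)
  obtain ⟨p, F, hF, hp⟩ := exists_seq_of_forall_finset h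
  refine ⟨fun n => (p n).1, fun n => (p n).2, fun n m n' m' hnm hmn heq => ?_⟩
  -- The newest element is `x n'`, the pair `(x m, y m)`, or `y m`, respectively; each case matches
  -- one clause of the recursive choice.
  rcases lt_trichotomy m n' with h | rfl | h
  · exact (hp n').1 _ (hF m' n' hmn) _ (hF n n' (hnm.trans h)) _ (hF m n' h) heq.symm
  · exact ((hp m).2 _ (hF n m hnm) _ (hF n m hnm) _ (hF m' m hmn)).2 heq
  · exact ((hp m).2 _ (hF n m hnm) _ (hF n' m h) _ (hF m' m (hmn.trans h))).1 heq

/-! ### Arens products -/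

section ArensLemmas

variable {A : Type*} [NonUnitalNormedRing A] [NormedSpace ℂ A] [IsScalarTower ℂ A A]
  [SMulCommClass ℂ A A]

/-- The two Arens products agree at `f` if `(a, b) ↦ f (a b)` has finite rank. -/
theorem firstArens_eq_secondArens_of_finite_rank {ι : Type*} (s : Finset ι)
    (φ ψ : ι → StrongDual ℂ A) (f : StrongDual ℂ A)
    (h : ∀ a b, f (a * b) = ∑ i ∈ s, φ i a * ψ i b)
    (Γ₁ Γ₂ : StrongDual ℂ (StrongDual ℂ A)) : firstArens Γ₁ Γ₂ f = secondArens Γ₁ Γ₂ f := by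
  -- Both products come out as `∑ Γ₁ (φ i) Γ₂ (ψ i)`.
  have h1 : arensAux (ContinuousLinearMap.mul ℂ A) Γ₂ f = ∑ i ∈ s, Γ₂ (ψ i) • φ i := by
    ext a
    have : f ∘L ContinuousLinearMap.mul ℂ A a = ∑ i ∈ s, φ i a • ψ i := by
      ext b
      simp [h]
    change Γ₂ (f ∘L ContinuousLinearMap.mul ℂ A a) = _
    rw [this]
    simp [mul_comm]
  have h2 : arensAux (ContinuousLinearMap.mul ℂ A).flip Γ₁ f = ∑ i ∈ s, Γ₁ (φ i) • ψ i := by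
    ext b
    have : f ∘L (ContinuousLinearMap.mul ℂ A).flip b = ∑ i ∈ s, ψ i b • φ i := by
      ext a
      simp [h, mul_comm]
    change Γ₁ (f ∘L (ContinuousLinearMap.mul ℂ A).flip b) = _
    rw [this]
    simp [mul_comm]
  change Γ₁ (arensAux _ Γ₂ f) = Γ₂ (arensAux _ Γ₁ f)
  rw [h1, h2]
  simp [mul_comm]

variable {B : Type*} [NonUnitalNormedRing B] [NormedSpace ℂ B] [IsScalarTower ℂ B B]
  [SMulCommClass ℂ B B]

/-- The second adjoint `θ** : A** → B**`. -/
noncomputable def bidualMap (θ : A →L[ℂ] B) (Γ : StrongDual ℂ (StrongDual ℂ A)) :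
    StrongDual ℂ (StrongDual ℂ B) :=
  Γ ∘L (ContinuousLinearMap.compL ℂ A B ℂ).flip θ

theorem firstArens_bidualMap (θ : A →L[ℂ] B) (hθ : ∀ a b, θ (a * b) = θ a * θ b)
    (Γ₁ Γ₂ : StrongDual ℂ (StrongDual ℂ A)) (f : StrongDual ℂ B) :
    firstArens (bidualMap θ Γ₁) (bidualMap θ Γ₂) f = firstArens Γ₁ Γ₂ (f ∘L θ) := by
  refine congrArg Γ₁ (ContinuousLinearMap.ext fun a => congrArg Γ₂ ?_)
  ext b
  exact congrArg f (hθ a b).symm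

theorem secondArens_bidualMap (θ : A →L[ℂ] B) (hθ : ∀ a b, θ (a * b) = θ a * θ b)
    (Γ₁ Γ₂ : StrongDual ℂ (StrongDual ℂ A)) (f : StrongDual ℂ B) :
    secondArens (bidualMap θ Γ₁) (bidualMap θ Γ₂) f = secondArens Γ₁ Γ₂ (f ∘L θ) := by
  refine congrArg Γ₂ (ContinuousLinearMap.ext fun b => congrArg Γ₁ ?_)
  ext a
  exact congrArg f (hθ a b).symm

/-- A bounded sequence has a weak* limit in the bidual along any ultrafilter. -/
theorem exists_bidual_limit {V ι : Type*} [NormedAddCommGroup V] [NormedSpace ℂ V]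
    (U : Ultrafilter ι) (x : ι → V) (hx : ∀ i, ‖x i‖ ≤ 1) :
    ∃ Γ : StrongDual ℂ (StrongDual ℂ V),
      ∀ f : StrongDual ℂ V, Filter.Tendsto (fun i => f (x i)) U (𝓝 (Γ f)) := by
  -- The values stay in a compact disc of radius `‖f‖`; keeping the bound on the limit makes the
  -- limit functional continuous.
  have hlim : ∀ f : StrongDual ℂ V, ∃ z : ℂ, ‖z‖ ≤ ‖f‖ ∧
      Filter.Tendsto (fun i => f (x i)) U (𝓝 z) := fun f => by
    have hb : ∀ i, f (x i) ∈ Metric.closedBall (0 : ℂ) ‖f‖ := fun i => by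
      rw [mem_closedBall_zero_iff]
      exact (f.le_opNorm _).trans (mul_le_of_le_one_right (norm_nonneg _) (hx i))
    obtain ⟨z, hz, hz'⟩ := (isCompact_closedBall (0 : ℂ) ‖f‖).ultrafilter_le_nhds
      (U.map fun i => f (x i))
      (Filter.le_principal_iff.2 (Filter.mem_map.2 (Filter.univ_mem' hb)))
    exact ⟨z, mem_closedBall_zero_iff.1 hz, hz'⟩
  choose L hL hL' using hlim
  refine ⟨LinearMap.mkContinuous
    { toFun := L
      map_add' := fun f g => tendsto_nhds_unique (hL' (f + g)) ((hL' f).add (hL' g))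
      map_smul' := fun c f => tendsto_nhds_unique (hL' (c • f)) ((hL' f).const_mul c) }
    1 fun f => (hL f).trans_eq (one_mul _).symm, hL'⟩

end ArensLemmas

/-! ### The ideals `J` -/

section

variable {A : Type*} [NonUnitalNormedRing A]

@[simp] theorem Tri.sub_a (s t : Tri A) : (s - t).a = s.a - t.a := rfl
@[simp] theorem Tri.sub_m (s t : Tri A) : (s - t).m = s.m - t.m := rfl
@[simp] theorem Tri.sub_b (s t : Tri A) : (s - t).b = s.b - t.b := rfl

end

section Ideals

variable {𝔄 A : Type*} [NonUnitalNormedRing 𝔄] [NormedSpace ℂ 𝔄] [NonUnitalNormedRing A]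
  [NormedSpace ℂ A] (X : CompatibleActions 𝔄 A)

theorem CompatibleActions.J_le {I : Submodule ℂ A} (h1 : IsClosed (I : Set A))
    (h2 : ∀ x ∈ I, ∀ c : A, c * x ∈ I ∧ x * c ∈ I)
    (h3 : ∀ (α : 𝔄) (a b : A), X.right α a * b - a * X.left α b ∈ I) : X.J ≤ I :=
  sInf_le ⟨h1, h2, h3⟩

theorem CompatibleActions.isClosed_J : IsClosed (X.J : Set A) := by
  rw [J, Submodule.coe_sInf]
  exact isClosed_biInter fun I hI => hI.1

theorem CompatibleActions.mul_mem_J {x : A} (hx : x ∈ X.J) (c : A) :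
    c * x ∈ X.J ∧ x * c ∈ X.J := by
  simp only [J, Submodule.mem_sInf] at hx ⊢
  exact ⟨fun I hI => (hI.2.1 x (hx I hI) c).1, fun I hI => (hI.2.1 x (hx I hI) c).2⟩

theorem CompatibleActions.generator_mem_J (α : 𝔄) (a b : A) :
    X.right α a * b - a * X.left α b ∈ X.J := by
  simp only [J, Submodule.mem_sInf]
  exact fun I hI => hI.2.2 α a b

variable {X}

/-- The kernel of a bounded homomorphism contains `J` if it contains the generators. -/
theorem CompatibleActions.J_le_ker {B : Type*} [NonUnitalNormedRing B] [NormedSpace ℂ B]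
    (θ : A →L[ℂ] B) (hθ : ∀ a b, θ (a * b) = θ a * θ b)
    (h : ∀ (α : 𝔄) (a b : A), θ (X.right α a * b) = θ (a * X.left α b)) {x : A} (hx : x ∈ X.J) :
    θ x = 0 := by
  refine X.J_le (I := LinearMap.ker (θ : A →ₗ[ℂ] B)) θ.isClosed_ker (fun x hx c => ?_)
    (fun α a b => ?_) hx
  · have hx' : θ x = 0 := hx
    constructor
    · change θ (c * x) = 0
      rw [hθ, hx', mul_zero]
    · change θ (x * c) = 0
      rw [hθ, hx', zero_mul]
  · change θ (_ - _) = 0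
    rw [map_sub, h, sub_self]

variable (A) in
/-- The inclusion `x ↦ [[x, 0], [0, 0]]`. -/
noncomputable def Tri.inclA : A →L[ℂ] Tri A :=
  LinearMap.mkContinuous
    { toFun := fun x => Tri.mk x 0 0
      map_add' := fun x y => Tri.ext (by simp) (by simp) (by simp)
      map_smul' := fun c x => Tri.ext (by simp) (by simp) (by simp) }
    1 fun x => by simp [Tri.norm_eq]

variable (A) in
/-- The inclusion `x ↦ [[0, x], [0, 0]]`. -/
noncomputable def Tri.inclM : A →L[ℂ] Tri A :=
  LinearMap.mkContinuous
    { toFun := fun x => Tri.mk 0 x 0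
      map_add' := fun x y => Tri.ext (by simp) (by simp) (by simp)
      map_smul' := fun c x => Tri.ext (by simp) (by simp) (by simp) }
    1 fun x => by simp [Tri.norm_eq]

variable (A) in
/-- The inclusion `x ↦ [[0, 0], [0, x]]`. -/
noncomputable def Tri.inclB : A →L[ℂ] Tri A :=
  LinearMap.mkContinuous
    { toFun := fun x => Tri.mk 0 0 x
      map_add' := fun x y => Tri.ext (by simp) (by simp) (by simp)
      map_smul' := fun c x => Tri.ext (by simp) (by simp) (by simp) }
    1 fun x => by simp [Tri.norm_eq]

variable (A) in
/-- The projection of the triangular algebra onto the first diagonal entry. -/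
noncomputable def Tri.projA : Tri A →L[ℂ] A :=
  LinearMap.mkContinuous
    { toFun := fun t => t.a
      map_add' := fun _ _ => rfl
      map_smul' := fun _ _ => rfl }
    1 fun t => (Tri.norm_a_le t).trans_eq (one_mul _).symm

variable (A) in
/-- The projection of the triangular algebra onto the upper right entry. -/
noncomputable def Tri.projM : Tri A →L[ℂ] A :=
  LinearMap.mkContinuous
    { toFun := fun t => t.m
      map_add' := fun _ _ => rfl
      map_smul' := fun _ _ => rfl }
    1 fun t => by
      change ‖t.m‖ ≤ 1 * ‖t‖
      rw [Tri.norm_eq]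
      linarith [norm_nonneg t.a, norm_nonneg t.b]

variable (A) in
/-- The projection of the triangular algebra onto the second diagonal entry. -/
noncomputable def Tri.projB : Tri A →L[ℂ] A :=
  LinearMap.mkContinuous
    { toFun := fun t => t.b
      map_add' := fun _ _ => rfl
      map_smul' := fun _ _ => rfl }
    1 fun t => by
      change ‖t.b‖ ≤ 1 * ‖t‖
      rw [Tri.norm_eq]
      linarith [norm_nonneg t.a, norm_nonneg t.m]

@[simp] theorem Tri.inclA_apply (x : A) : Tri.inclA A x = Tri.mk x 0 0 := rfl
@[simp] theorem Tri.inclM_apply (x : A) : Tri.inclM A x = Tri.mk 0 x 0 := rfl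
@[simp] theorem Tri.inclB_apply (x : A) : Tri.inclB A x = Tri.mk 0 0 x := rfl

/-- The diagonal matrix `[[α, 0], [0, α]]`. -/
def Tri.scalar (α : 𝔄) : Tri.scalars 𝔄 := ⟨Tri.mk α 0 α, rfl, rfl⟩

@[simp] theorem Tri.scalar_coe (α : 𝔄) : (Tri.scalar α).1 = Tri.mk α 0 α := rfl

/-- The first diagonal entry is a homomorphism sending generators to generators, so the preimage of
`X.J` is a closed ideal containing all generators. -/
theorem Tri.a_mem_J {t : Tri A} (ht : t ∈ (Tri.actions X).J) : t.a ∈ X.J := by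
  refine (Tri.actions X).J_le (I := X.J.comap (Tri.projA A : Tri A →ₗ[ℂ] A))
    (X.isClosed_J.preimage (Tri.projA A).continuous) (fun x hx c => ?_) (fun τ s t => ?_) ht
  · exact X.mul_mem_J hx c.a
  · exact X.generator_mem_J τ.1.a s.a t.a

/-- A bounded linear map whose range is compatible with multiplication maps `J` into `J` if it does
so on generators. -/
theorem CompatibleActions.map_mem_J {𝔅 B : Type*} [NonUnitalNormedRing 𝔅] [NormedSpace ℂ 𝔅]
    [NonUnitalNormedRing B] [NormedSpace ℂ B] {Y : CompatibleActions 𝔅 B} (θ : A →L[ℂ] B)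
    (hl : ∀ c, ∃ d, ∀ x, θ (c * x) = d * θ x) (hr : ∀ c, ∃ d, ∀ x, θ (x * c) = θ x * d)
    (hg : ∀ (α : 𝔄) (a b : A), θ (X.right α a * b - a * X.left α b) ∈ Y.J) {x : A}
    (hx : x ∈ X.J) : θ x ∈ Y.J := by
  refine X.J_le (I := Y.J.comap (θ : A →ₗ[ℂ] B)) (Y.isClosed_J.preimage θ.continuous)
    (fun x hx c => ⟨?_, ?_⟩) hg hx
  · obtain ⟨d, hd⟩ := hl c
    change θ (c * x) ∈ Y.J
    rw [hd]
    exact (Y.mul_mem_J hx d).1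
  · obtain ⟨d, hd⟩ := hr c
    change θ (x * c) ∈ Y.J
    rw [hd]
    exact (Y.mul_mem_J hx d).2

theorem Tri.inclA_mem_J {x : A} (hx : x ∈ X.J) : Tri.inclA A x ∈ (Tri.actions X).J := by
  refine CompatibleActions.map_mem_J (Tri.inclA A)
    (fun c => ⟨Tri.mk c 0 0, fun x => Tri.ext (by simp) (by simp) (by simp)⟩)
    (fun c => ⟨Tri.mk c 0 0, fun x => Tri.ext (by simp) (by simp) (by simp)⟩)
    (fun α s t => ?_) hx
  convert (Tri.actions X).generator_mem_J (Tri.scalar α) (Tri.mk s 0 0) (Tri.mk t 0 0) using 1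
  apply Tri.ext <;> simp [Tri.actions, Tri.entrywise_apply]

/-- The corner is not embedded multiplicatively, but it is a bimodule: left factors act through the
first diagonal entry and right factors through the second. -/
theorem Tri.inclM_mem_J {x : A} (hx : x ∈ X.J) : Tri.inclM A x ∈ (Tri.actions X).J := by
  refine CompatibleActions.map_mem_J (Tri.inclM A)
    (fun c => ⟨Tri.mk c 0 0, fun x => Tri.ext (by simp) (by simp) (by simp)⟩)
    (fun c => ⟨Tri.mk 0 0 c, fun x => Tri.ext (by simp) (by simp) (by simp)⟩)
    (fun α s t => ?_) hx
  convert (Tri.actions X).generator_mem_J (Tri.scalar α) (Tri.mk s 0 0) (Tri.mk 0 t 0) using 1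
  apply Tri.ext <;> simp [Tri.actions, Tri.entrywise_apply]

theorem Tri.inclB_mem_J {x : A} (hx : x ∈ X.J) : Tri.inclB A x ∈ (Tri.actions X).J := by
  refine CompatibleActions.map_mem_J (Tri.inclB A)
    (fun c => ⟨Tri.mk 0 0 c, fun x => Tri.ext (by simp) (by simp) (by simp)⟩)
    (fun c => ⟨Tri.mk 0 0 c, fun x => Tri.ext (by simp) (by simp) (by simp)⟩)
    (fun α s t => ?_) hx
  convert (Tri.actions X).generator_mem_J (Tri.scalar α) (Tri.mk 0 0 s) (Tri.mk 0 0 t) using 1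
  apply Tri.ext <;> simp [Tri.actions, Tri.entrywise_apply]

theorem Tri.apply_eq_add (F : StrongDual ℂ (Tri A)) (t : Tri A) :
    F t = (F ∘L Tri.inclA A) t.a + (F ∘L Tri.inclM A) t.m + (F ∘L Tri.inclB A) t.b := by
  change F t = F _ + F _ + F _
  rw [← map_add, ← map_add]
  exact congrArg F (Tri.ext (by simp) (by simp) (by simp))

variable [IsScalarTower ℂ A A] [SMulCommClass ℂ A A]

/-- Module Arens regularity says that the Arens products agree on the annihilator of `J`. -/
theorem CompatibleActions.moduleArensRegular_iff : X.ModuleArensRegular ↔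
    ∀ Γ₁ Γ₂ : StrongDual ℂ (StrongDual ℂ A), ∀ f ∈ annihilator X.J,
      firstArens Γ₁ Γ₂ f = secondArens Γ₁ Γ₂ f :=
  forall₂_congr fun _ _ => forall₂_congr fun _ _ => sub_eq_zero

/-- `Γ₁` and `Γ₂` are pushed forward along the homomorphism `Tri.inclA`, and `f` is pulled back
along its left inverse `Tri.projA`. -/
theorem Tri.moduleArensRegular_of_actions (h : (Tri.actions X).ModuleArensRegular) :
    X.ModuleArensRegular := by
  rw [CompatibleActions.moduleArensRegular_iff] at h ⊢
  intro Γ₁ Γ₂ f hf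
  have hθ : ∀ a b : A, Tri.inclA A (a * b) = Tri.inclA A a * Tri.inclA A b := fun a b =>
    Tri.ext (by simp) (by simp) (by simp)
  have hF := h (bidualMap (Tri.inclA A) Γ₁) (bidualMap (Tri.inclA A) Γ₂) (f ∘L Tri.projA A)
    fun t ht => hf t.a (Tri.a_mem_J ht)
  rwa [firstArens_bidualMap _ hθ, secondArens_bidualMap _ hθ] at hF

/-- If every functional vanishing on `J` is of finite rank on products, uniformly, then the
triangular algebra is module Arens regular. -/
theorem Tri.moduleArensRegular_of_finite_rank {ι : Type*} [Fintype ι] (φ ψ : ι → StrongDual ℂ A)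
    (h : ∀ f ∈ annihilator X.J, ∃ c : ι → ℂ, ∀ a b, f (a * b) = ∑ i, c i * φ i a * ψ i b) :
    (Tri.actions X).ModuleArensRegular := by
  rw [CompatibleActions.moduleArensRegular_iff]
  intro Γ₁ Γ₂ F hF
  obtain ⟨c₁, h₁⟩ := h (F ∘L Tri.inclA A) fun x hx => hF _ (Tri.inclA_mem_J hx)
  obtain ⟨c₂, h₂⟩ := h (F ∘L Tri.inclM A) fun x hx => hF _ (Tri.inclM_mem_J hx)
  obtain ⟨c₃, h₃⟩ := h (F ∘L Tri.inclB A) fun x hx => hF _ (Tri.inclB_mem_J hx)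
  -- The four blocks are the products `a a'`, `a m'`, `m b'`, `b b'` of entries; the middle two make
  -- up the corner and share the coefficients `c₂`.
  refine firstArens_eq_secondArens_of_finite_rank (Finset.univ : Finset (Fin 4 × ι))
    (fun p => ![c₁ p.2 • φ p.2 ∘L Tri.projA A, c₂ p.2 • φ p.2 ∘L Tri.projA A,
      c₂ p.2 • φ p.2 ∘L Tri.projM A, c₃ p.2 • φ p.2 ∘L Tri.projB A] p.1)
    (fun p => ![ψ p.2 ∘L Tri.projA A, ψ p.2 ∘L Tri.projM A,
      ψ p.2 ∘L Tri.projB A, ψ p.2 ∘L Tri.projB A] p.1) F (fun s t => ?_) Γ₁ Γ₂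
  rw [Tri.apply_eq_add, Tri.mul_a, Tri.mul_m, Tri.mul_b, map_add, h₁, h₂, h₂, h₃,
    Fintype.sum_prod_type, Fin.sum_univ_four, ← add_assoc]
  rfl

end Ideals

/-! ### The semigroup algebra -/

section SemigroupAlgebra

variable {S : Type*} [Semigroup S]

/-- The homomorphism `ℓ¹(S) → ℓ¹(S / c)` induced by the quotient map. -/
noncomputable def toQuotient (c : Con S) : L1 S →L[ℂ] L1 c.Quotient :=
  L1.lift (fun s => L1.delta (s : c.Quotient)) fun _ => (L1.norm_delta _).le

theorem toQuotient_delta (c : Con S) (s : S) :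
    toQuotient c (L1.delta s) = L1.delta (s : c.Quotient) :=
  L1.lift_delta _ _ s

theorem toQuotient_bilin {X Y : Type*} (c : Con S) (op : X → Y → S) (f : L1 X) (g : L1 Y) :
    toQuotient c (L1.bilin op f g) = L1.bilin (fun x y => (op x y : c.Quotient)) f g := by
  have key : (ContinuousLinearMap.compL ℂ (L1 Y) (L1 S) (L1 c.Quotient) (toQuotient c)) ∘L
      L1.bilin op = L1.bilin fun x y => (op x y : c.Quotient) :=
    L1.clm_ext fun x => L1.clm_ext fun y => by simp [L1.bilin_delta, toQuotient_delta]
  exact congrArg (fun T => T f g) key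

theorem toQuotient_mul (c : Con S) (a b : L1 S) :
    toQuotient c (a * b) = toQuotient c a * toQuotient c b := by
  have key : (ContinuousLinearMap.compL ℂ (L1 S) (L1 S) (L1 c.Quotient) (toQuotient c)) ∘L
        ContinuousLinearMap.mul ℂ (L1 S) =
      (ContinuousLinearMap.mul ℂ (L1 c.Quotient)).bilinearComp (toQuotient c) (toQuotient c) :=
    L1.clm_ext fun s => L1.clm_ext fun t => by
      simp [L1.delta_mul_delta, toQuotient_delta]
  exact congrArg (fun T => T a b) key

variable [IsInverseSemigroup S]

theorem apply_delta_eq_of_leastGroupCon {f : StrongDual ℂ (L1 S)}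
    (hf : f ∈ annihilator (semigroupActions S).J) {s t : S} (h : leastGroupCon S s t) :
    f (L1.delta s) = f (L1.delta t) := by
  refine eq_of_leastGroupCon (φ := fun s => f (L1.delta s)) (fun s e t he => ?_) h
  have key := hf _ ((semigroupActions S).generator_mem_J (L1.delta ⟨e, he⟩) (L1.delta s)
    (L1.delta t))
  have hr : (semigroupActions S).right (L1.delta ⟨e, he⟩) (L1.delta s) = L1.delta (s * e) :=
    L1.bilin_delta _ _ _
  have hl : (semigroupActions S).left (L1.delta ⟨e, he⟩) (L1.delta t) = L1.delta t :=
    L1.bilin_delta _ _ _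
  rwa [hr, hl, L1.delta_mul_delta, L1.delta_mul_delta, map_sub, sub_eq_zero] at key

theorem actions_moduleArensRegular_of_finite [Finite (MaxGroupImage S)] :
    (Tri.actions (semigroupActions S)).ModuleArensRegular := by
  classical
  let G := (leastGroupCon S).Quotient
  have : Finite G := ‹Finite (MaxGroupImage S)›
  have := Fintype.ofFinite G
  let χ : G → StrongDual ℂ (L1 S) := fun x =>
    L1.lift (fun s : S => if (s : G) = x then (1 : ℂ) else 0)
      fun s => by split_ifs <;> simp
  have hχ : ∀ x s, χ x (L1.delta s) = if (s : G) = x then (1 : ℂ) else 0 := fun x s =>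
    L1.lift_delta _ _ s
  let r : G → S := Quotient.out
  have hr : ∀ x : G, (r x : G) = x := fun x => Quotient.out_eq x
  refine Tri.moduleArensRegular_of_finite_rank (ι := G × G) (fun p => χ p.1) (fun p => χ p.2)
    fun f hf => ⟨fun p => f (L1.delta (r p.1 * r p.2)), fun a b => ?_⟩
  -- On point masses only the pair of classes of `s` and `t` survives in the sum, and `f` does not
  -- distinguish `s * t` from the product of the representatives.
  have key : (ContinuousLinearMap.compL ℂ (L1 S) (L1 S) ℂ f) ∘L ContinuousLinearMap.mul ℂ (L1 S) =
      ∑ p : G × G, f (L1.delta (r p.1 * r p.2)) • (χ p.1).smulRight (χ p.2) := by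
    refine L1.clm_ext fun s => L1.clm_ext fun t => ?_
    simp only [ContinuousLinearMap.comp_apply, ContinuousLinearMap.compL_apply,
      ContinuousLinearMap.mul_apply', sum_apply, smul_apply,
      ContinuousLinearMap.smulRight_apply, hχ, L1.delta_mul_delta, smul_eq_mul]
    rw [Finset.sum_eq_single ((s : G), (t : G))]
    · simp only [if_true, mul_one]
      refine apply_delta_eq_of_leastGroupCon hf ((leastGroupCon S).mul ?_ ?_)
      · exact (Con.eq _).1 (hr _).symm
      · exact (Con.eq _).1 (hr _).symm
    · intro p _ hp
      by_cases h1 : (s : G) = p.1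
      · have h2 : (t : G) ≠ p.2 := fun h2 => hp (Prod.ext h1.symm h2.symm)
        simp [h2]
      · simp [h1]
    · simp
  have := congrArg (fun T => T a b) key
  simpa [sum_apply, mul_assoc] using this

theorem toQuotient_eq_zero [Nonempty S] {x : L1 S} (hx : x ∈ (semigroupActions S).J) :
    toQuotient (leastGroupCon S) x = 0 := by
  set c := leastGroupCon S
  refine CompatibleActions.J_le_ker (toQuotient c) (toQuotient_mul c) (fun α a b => ?_) hx
  obtain ⟨e, h1, -, h3⟩ := (isGroupCon_leastGroupCon S).idem
  -- Idempotents become the identity of the group; `L1.bilin_assoc` extends this from point masses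
  -- to all `α`, `a`, `b`.
  have h : ∀ (s : S) (i : Idem S) (t : S), ((s * i.1 * t : S) : c.Quotient) = (s * t : S) := by
    intro s i t
    have hi : (i.1 : c.Quotient) = e := h3 _ (by rw [← Con.coe_mul, i.2])
    rw [Con.coe_mul, Con.coe_mul, Con.coe_mul, mul_assoc, hi, h1]
  calc toQuotient c ((semigroupActions S).right α a * b)
      = L1.bilin (fun s t => ((s * t : S) : c.Quotient))
          (L1.bilin (fun (s : S) (i : Idem S) => s * i.1) a α) b := by
        rw [L1.mul_def, toQuotient_bilin, L1.bilin_swap (fun (s : S) (i : Idem S) => s * i.1)]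
        rfl
    _ = L1.bilin (fun s t => ((s * t : S) : c.Quotient)) a
          (L1.bilin (fun (_ : Idem S) (t : S) => t) α b) := L1.bilin_assoc _ _ _ _ h a α b
    _ = toQuotient c (a * (semigroupActions S).left α b) := by
        rw [L1.mul_def, toQuotient_bilin]
        rfl

theorem finite_of_moduleArensRegular [Nonempty S] (h : (semigroupActions S).ModuleArensRegular) :
    Finite (MaxGroupImage S) := by
  classical
  let G := (leastGroupCon S).Quotient
  change Finite G
  by_contra hG
  have : Infinite G := not_finite_iff_infinite.1 hG
  have : IsCancelMul G := (isGroupCon_leastGroupCon S).cancel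
  obtain ⟨x, y, hxy⟩ := exists_seq_mul_ne (G := G)
  let r : G → S := Quotient.out
  have hr : ∀ x : G, (r x : G) = x := fun x => Quotient.out_eq x
  -- The functional is the indicator of the products above the diagonal, pulled back to `ℓ¹(S)`.
  let P : G → Prop := fun z => ∃ n m, n < m ∧ x n * y m = z
  let g : StrongDual ℂ (L1 G) := L1.lift (fun z => if P z then (1 : ℂ) else 0)
    fun z => by split_ifs <;> simp
  let f : StrongDual ℂ (L1 S) := g ∘L toQuotient (leastGroupCon S)
  have hf : f ∈ annihilator (semigroupActions S).J := fun a ha => by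
    change g (toQuotient _ a) = 0
    rw [toQuotient_eq_zero ha, map_zero]
  have hval : ∀ n m, f (L1.delta (r (x n)) * L1.delta (r (y m))) =
      if P (x n * y m) then (1 : ℂ) else 0 := fun n m => by
    change g (toQuotient _ _) = _
    rw [toQuotient_mul, toQuotient_delta, toQuotient_delta, hr, hr, L1.delta_mul_delta]
    exact L1.lift_delta _ _ _
  obtain ⟨Γ₁, hΓ₁⟩ := exists_bidual_limit (Filter.hyperfilter ℕ) (fun n => L1.delta (r (x n)))
    fun n => (L1.norm_delta _).le
  obtain ⟨Γ₂, hΓ₂⟩ := exists_bidual_limit (Filter.hyperfilter ℕ) (fun n => L1.delta (r (y n)))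
    fun n => (L1.norm_delta _).le
  -- Nonprincipality matters here: in each iterated limit the inner index eventually exceeds the
  -- outer one, so the first order of limits sees only `n < m` and the second only `m < n`.
  have hgt : ∀ n : ℕ, ∀ᶠ m in (Filter.hyperfilter ℕ : Filter ℕ), n < m := fun n =>
    (Nat.hyperfilter_le_atTop) (Filter.eventually_gt_atTop n)
  obtain ⟨z, hz, hz'⟩ := firstArens_iterated_limit Γ₁ Γ₂ _ _ hΓ₁ hΓ₂ f
  obtain ⟨w, hw, hw'⟩ := secondArens_iterated_limit Γ₁ Γ₂ _ _ hΓ₁ hΓ₂ f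
  have z1 : ∀ n, z n = 1 := fun n => by
    refine tendsto_nhds_unique (hz n) (tendsto_const_nhds.congr' ?_)
    filter_upwards [hgt n] with m hm
    rw [hval, if_pos ⟨n, m, hm, rfl⟩]
  have w0 : ∀ m, w m = 0 := fun m => by
    refine tendsto_nhds_unique (hw m) (tendsto_const_nhds.congr' ?_)
    filter_upwards [hgt m] with n hn
    rw [hval, if_neg]
    rintro ⟨n', m', hlt, heq⟩
    exact hxy n' m' n m hlt hn heq
  have e1 : firstArens Γ₁ Γ₂ f = 1 :=
    tendsto_nhds_unique hz' (tendsto_const_nhds.congr fun n => (z1 n).symm)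
  have e0 : secondArens Γ₁ Γ₂ f = 0 :=
    tendsto_nhds_unique hw' (tendsto_const_nhds.congr fun n => (w0 n).symm)
  have := CompatibleActions.moduleArensRegular_iff.1 h Γ₁ Γ₂ f hf
  rw [e1, e0] at this
  exact one_ne_zero this

end SemigroupAlgebra

theorem mainTheorem4 (S : Type*) [Semigroup S] [IsInverseSemigroup S] [Nonempty S] :
    ((Tri.actions (semigroupActions S)).ModuleArensRegular ↔
      (semigroupActions S).ModuleArensRegular) ∧
    ((Tri.actions (semigroupActions S)).ModuleArensRegular ↔ Finite (MaxGroupImage S)) := by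
  have h1 : (Tri.actions (semigroupActions S)).ModuleArensRegular →
      (semigroupActions S).ModuleArensRegular := Tri.moduleArensRegular_of_actions
  have h2 : (semigroupActions S).ModuleArensRegular → Finite (MaxGroupImage S) :=
    finite_of_moduleArensRegular
  have h3 : Finite (MaxGroupImage S) → (Tri.actions (semigroupActions S)).ModuleArensRegular :=
    fun _ => actions_moduleArensRegular_of_finite
  exact ⟨⟨h1, fun h => h3 (h2 h)⟩, ⟨fun h => h2 (h1 h), h3⟩⟩
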